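/- Let $\mathbb K$ be $\mathbb R$ or $\mathbb C$. A Fréchet algebra $(\mathcal A,p_n)_{n\in\mathbb N}$ is a (not necessarily unital) associative $\mathbb K$-algebra with a complete Hausdorff topology given by an increasing sequence of submultiplicative seminorms $p_n$. For a closed two-sided ideal $I$ of $\mathcal A$ let $\hat p_n(a+I)=\inf_{b\in I}p_n(a+b)$ on $\mathcal A/I$, and let $\hat r_n$ be the corresponding projective tensor seminorms on the completed projective tensor product $\frac{\mathcal A}{I}\widehat\otimes\frac{\mathcal A}{I}$, with the $\mathcal A$-bimodule actions determined by $a\cdot((b+I)\otimes (c+I))=(ab+I)\otimes (c+I)$, $((b+I)\otimes (c+I))\cdot a=(b+I)\otimes (ca+I)$. Let $\pi_{\mathcal A/I}:\frac{\mathcal A}{I}\widehat\otimes\frac{\mathcal A}{I}\to\frac{\mathcal A}{I}$ be the continuous linear map with $(a+I)\otimes(b+I)\mapsto ab+I$, and write $\tilde a=a+I$. $\mathcal A$ has a *locally bounded approximate diagonal modulo $I$* if there are constants $C_n>0$ $(n\in\mathbb N)$ such that for every finite set $F\subseteq\mathcal A\setminus I$, every $n\in\mathbb N$ and every $\varepsilon>0$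 there is $M\in\frac{\mathcal A}{I}\widehat\otimes\frac{\mathcal A}{I}$ with $\hat r_n(M)\le C_n$ and, for all $a\in F$, $$\hat r_n(a\cdot M-M\cdot a)<\varepsilon,\qquad \hat p_n(a\cdot\pi_{\mathcal A/I}(M)-\tilde a)<\varepsilon .$$ A Banach algebra $\mathcal B$ has a *bounded approximate diagonal modulo* a closed ideal $J$ if there is a norm-bounded net $(m_\alpha)$ in the Banach space projective tensor product $\frac{\mathcal B}{J}\widehat\otimes\frac{\mathcal B}{J}$ such that $b\cdot\pi_{\mathcal B/J}(m_\alpha)-\tilde b\to0$ for all $b\in\mathcal B$ and $b\cdot m_\alpha-m_\alpha\cdot b\to0$ for all $b\in\mathcal B\setminus J$. An *Arens–Michael decomposition* $\mathcal A=\varprojlim\mathcal A_n$ consists of Banach algebras $\mathcal A_n$ $(n\in\mathbb N)$, continuous homomorphisms $d_n:\mathcal A_{n+1}\to\mathcal A_n$, and homomorphisms $\varphi_n:\mathcal A\to\mathcal A_n$ with dense range, such that $a\mapsto(\varphi_n(a))_n$ is a topological isomorphism of $\mathcal A$ onto the inverse limit $\{(x_n)\in\prod_n\mathcal A_n: d_n(x_{n+1})=x_n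 \text{ for all } n\}$ (for example, $\mathcal A_n$ the completion of $\mathcal A/\ker p_n$ in the norm induced by $p_n$). **Statement.** Let $(\mathcal A,p_n)$ be a Fréchet algebra, $I$ a closed two-sided ideal of $\mathcal A$, and $\mathcal A=\varprojlim\mathcal A_n$ an Arens–Michael decomposition. Let $I_n=\varphi_n(I)$ and let $\overline{I_n}$ be its closure in $\mathcal A_n$ (so that $I=\varprojlim\overline{I_n}$). Then $\mathcal A$ has a locally bounded approximate diagonal modulo $I$ if and only if, for every $n$, the Banach algebra $\mathcal A_n$ has a bounded approximate diagonal modulo $\overline{I_n}$. -/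

import Mathlib

open Filter Topology
open scoped TensorProduct

universe u v

noncomputable section

/-! ### Locally convex spaces given by a family of seminorms, and their completions -/

section SeminormedBy

variable {𝕜 : Type*} [RCLike 𝕜] {ι κ : Type*} {E F : Type*} [AddCommGroup E] [Module 𝕜 E]
  [AddCommGroup F] [Module 𝕜 F]

/-- The vector space `E` with the locally convex topology (and uniformity) generated by the
family of seminorms `p`. -/
def SeminormedBy (_p : ι → Seminorm 𝕜 E) : Type _ := E

namespace SeminormedBy

variable (p : ι → Seminorm 𝕜 E) (q : κ → Seminorm 𝕜 F)

instance : AddCommGroup (SeminormedBy p) := inferInstanceAs (AddCommGroup E)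

instance : Module 𝕜 (SeminormedBy p) := inferInstanceAs (Module 𝕜 E)

/-- The coarsest uniformity making all pseudometrics `(x, y) ↦ p i (x - y)` uniformly
continuous. -/
instance : UniformSpace (SeminormedBy p) :=
  ⨅ i, ((p i).toAddGroupSeminorm.toSeminormedAddCommGroup).toUniformSpace

instance : IsUniformAddGroup (SeminormedBy p) :=
  isUniformAddGroup_iInf fun i =>
    @SeminormedAddCommGroup.to_isUniformAddGroup E
      (p i).toAddGroupSeminorm.toSeminormedAddCommGroup

theorem uniformContinuous_seminorm (i : ι) :
    UniformContinuous (fun x : SeminormedBy p => p i x) := by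
  have h := @uniformContinuous_norm E (p i).toAddGroupSeminorm.toSeminormedAddCommGroup.toSeminormedAddGroup
  exact uniformContinuous_iInf_dom (i := i) h

variable {p q}

theorem uniformContinuous_of_bound (f : E →ₗ[𝕜] F)
    (hf : ∀ j, ∃ (i : ι) (C : ℝ), ∀ x, q j (f x) ≤ C * p i x) :
    @UniformContinuous (SeminormedBy p) (SeminormedBy q) _ _ f := by
  refine uniformContinuous_iInf_rng.2 fun j => ?_
  obtain ⟨i, C, h⟩ := hf j
  refine uniformContinuous_iInf_dom (i := i) ?_
  let _ := (p i).toAddGroupSeminorm.toSeminormedAddCommGroup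
  let _ := (q j).toAddGroupSeminorm.toSeminormedAddCommGroup
  exact (AddMonoidHomClass.uniformContinuous_of_bound f.toAddMonoidHom C h)

instance : UniformContinuousConstSMul 𝕜 (SeminormedBy p) where
  uniformContinuous_const_smul c :=
    uniformContinuous_of_bound (p := p) (q := p) (c • (LinearMap.id : E →ₗ[𝕜] E)) fun j =>
      ⟨j, ‖c‖, fun x => by simp [map_smul_eq_mul]⟩

/-- A linear map that satisfies seminorm estimates, as a continuous linear map. -/
def mapCLM (f : E →ₗ[𝕜] F) (hf : ∀ j, ∃ (i : ι) (C : ℝ), ∀ x, q j (f x) ≤ C * p i x) :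
    SeminormedBy p →L[𝕜] SeminormedBy q :=
  { (show SeminormedBy p →ₗ[𝕜] SeminormedBy q from f) with
    cont := (uniformContinuous_of_bound f hf).continuous }

end SeminormedBy

/-- The Hausdorff completion of `E` for the topology generated by the seminorms `p`. -/
abbrev LCCompletion (p : ι → Seminorm 𝕜 E) : Type _ :=
  UniformSpace.Completion (SeminormedBy p)

/-- The canonical map of `E` into its completion. -/
def LCCompletion.of (p : ι → Seminorm 𝕜 E) (x : E) : LCCompletion p :=
  ((show SeminormedBy p from x : SeminormedBy p) : UniformSpace.Completion (SeminormedBy p))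

/-- The continuous extension of the seminorm `p i` to the completion. -/
def LCCompletion.seminorm (p : ι → Seminorm 𝕜 E) (i : ι) : LCCompletion p → ℝ :=
  UniformSpace.Completion.extension (fun x : SeminormedBy p => p i x)

theorem LCCompletion.seminorm_of (p : ι → Seminorm 𝕜 E) (i : ι) (x : E) :
    LCCompletion.seminorm p i (LCCompletion.of p x) = p i x :=
  UniformSpace.Completion.extension_coe (SeminormedBy.uniformContinuous_seminorm p i) _

theorem LCCompletion.continuous_seminorm (p : ι → Seminorm 𝕜 E) (i : ι) :
    Continuous (LCCompletion.seminorm p i) :=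
  UniformSpace.Completion.continuous_extension

/-- The continuous extension to the completions of a linear map with seminorm estimates. -/
def LCCompletion.map {p : ι → Seminorm 𝕜 E} {q : κ → Seminorm 𝕜 F} (f : E →ₗ[𝕜] F)
    (hf : ∀ j, ∃ (i : ι) (C : ℝ), ∀ x, q j (f x) ≤ C * p i x) :
    LCCompletion p →L[𝕜] LCCompletion q :=
  (SeminormedBy.mapCLM f hf).completion

theorem LCCompletion.map_of {p : ι → Seminorm 𝕜 E} {q : κ → Seminorm 𝕜 F} (f : E →ₗ[𝕜] F)
    (hf : ∀ j, ∃ (i : ι) (C : ℝ), ∀ x, q j (f x) ≤ C * p i x) (x : E) :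
    LCCompletion.map f hf (LCCompletion.of p x) = LCCompletion.of q (f x) :=
  ContinuousLinearMap.completion_apply_coe _ _

end SeminormedBy

/-! ### Quotient seminorms and projective tensor seminorms -/

section Seminorms

variable {𝕜 : Type*} [RCLike 𝕜] {E F G : Type*} [AddCommGroup E] [Module 𝕜 E]
  [AddCommGroup F] [Module 𝕜 F] [AddCommGroup G] [Module 𝕜 G]

theorem quotientSeminorm_bddBelow (p : Seminorm 𝕜 E) (S : Submodule 𝕜 E) (x : E ⧸ S) :
    BddBelow (Set.range fun a : {a : E // S.mkQ a = x} => p a) :=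
  ⟨0, by rintro _ ⟨a, rfl⟩; exact apply_nonneg p _⟩

instance quotientSeminorm_nonempty (S : Submodule 𝕜 E) (x : E ⧸ S) :
    Nonempty {a : E // S.mkQ a = x} :=
  let ⟨a, ha⟩ := S.mkQ_surjective x
  ⟨⟨a, ha⟩⟩

/-- The quotient seminorm `a + S ↦ inf {p (a + b) : b ∈ S}`, the infimum being taken over all
representatives of the class. -/
def quotientSeminorm (p : Seminorm 𝕜 E) (S : Submodule 𝕜 E) : Seminorm 𝕜 (E ⧸ S) :=
  Seminorm.ofSMulLE (fun x => ⨅ a : {a : E // S.mkQ a = x}, p a)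
    (le_antisymm
      ((ciInf_le (quotientSeminorm_bddBelow p S 0) ⟨0, map_zero _⟩).trans (by simp))
      (Real.iInf_nonneg fun a => apply_nonneg p _))
    (fun x y => le_ciInf_add_ciInf fun a b =>
      (ciInf_le (quotientSeminorm_bddBelow p S (x + y))
        ⟨a.1 + b.1, by rw [map_add, a.2, b.2]⟩).trans (map_add_le_add p _ _))
    (fun r x => by
      rw [Real.mul_iInf_of_nonneg (norm_nonneg _)]
      exact le_ciInf fun a =>
        (ciInf_le (quotientSeminorm_bddBelow p S (r • x))
          ⟨r • a.1, by rw [map_smul, a.2]⟩).trans (map_smul_eq_mul p r _).le)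

theorem quotientSeminorm_apply (p : Seminorm 𝕜 E) (S : Submodule 𝕜 E) (x : E ⧸ S) :
    quotientSeminorm p S x = ⨅ a : {a : E // S.mkQ a = x}, p a := rfl

theorem quotientSeminorm_mkQ_le (p : Seminorm 𝕜 E) (S : Submodule 𝕜 E) (a : E) :
    quotientSeminorm p S (S.mkQ a) ≤ p a :=
  ciInf_le (quotientSeminorm_bddBelow p S _) ⟨a, rfl⟩

/-- `l` represents `u` as a finite sum of elementary tensors. -/
def TensorRep (l : List (E × F)) (u : E ⊗[𝕜] F) : Prop :=
  (l.map fun z => z.1 ⊗ₜ[𝕜] z.2).sum = u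

/-- The cost `∑ p xᵢ * q yᵢ` of a finite list of pairs. -/
def tensorCost (p : Seminorm 𝕜 E) (q : Seminorm 𝕜 F) (l : List (E × F)) : ℝ :=
  (l.map fun z => p z.1 * q z.2).sum

theorem tensorCost_nonneg (p : Seminorm 𝕜 E) (q : Seminorm 𝕜 F) (l : List (E × F)) :
    0 ≤ tensorCost p q l := by
  refine List.sum_nonneg fun a ha => ?_
  obtain ⟨z, _, rfl⟩ := List.mem_map.1 ha
  exact mul_nonneg (apply_nonneg _ _) (apply_nonneg _ _)

theorem tensorCost_bddBelow (p : Seminorm 𝕜 E) (q : Seminorm 𝕜 F) (u : E ⊗[𝕜] F) :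
    BddBelow (Set.range fun l : {l : List (E × F) // TensorRep l u} => tensorCost p q l) :=
  ⟨0, by rintro _ ⟨l, rfl⟩; exact tensorCost_nonneg p q _⟩

theorem TensorRep.smul {l : List (E × F)} {u : E ⊗[𝕜] F} (h : TensorRep l u) (r : 𝕜) :
    TensorRep (l.map fun z => (r • z.1, z.2)) (r • u) := by
  unfold TensorRep at *
  rw [← h, List.smul_sum]
  simp [Function.comp_def, TensorProduct.smul_tmul']

theorem tensorCost_smul (p : Seminorm 𝕜 E) (q : Seminorm 𝕜 F) (l : List (E × F)) (r : 𝕜) :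
    tensorCost p q (l.map fun z => (r • z.1, z.2)) = ‖r‖ * tensorCost p q l := by
  simp [tensorCost, Function.comp_def, map_smul_eq_mul, mul_assoc, List.sum_map_mul_left]

instance tensorRep_nonempty (u : E ⊗[𝕜] F) :
    Nonempty {l : List (E × F) // TensorRep l u} := by
  induction u with
  | zero => exact ⟨⟨[], rfl⟩⟩
  | tmul x y => exact ⟨⟨[(x, y)], by simp [TensorRep]⟩⟩
  | add u v hu hv =>
    obtain ⟨⟨l, hl⟩⟩ := hu
    obtain ⟨⟨m, hm⟩⟩ := hv
    exact ⟨⟨l ++ m, by simp only [TensorRep] at *; simp [hl, hm]⟩⟩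

/-- The projective tensor seminorm
`u ↦ inf {∑ p xᵢ * q yᵢ : u = ∑ xᵢ ⊗ yᵢ}` on the algebraic tensor product. -/
def projectiveTensorSeminorm (p : Seminorm 𝕜 E) (q : Seminorm 𝕜 F) :
    Seminorm 𝕜 (E ⊗[𝕜] F) :=
  Seminorm.ofSMulLE (fun u => ⨅ l : {l : List (E × F) // TensorRep l u}, tensorCost p q l)
    (le_antisymm
      ((ciInf_le (tensorCost_bddBelow p q 0) ⟨[], rfl⟩).trans (by simp [tensorCost]))
      (Real.iInf_nonneg fun l => tensorCost_nonneg p q _))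
    (fun u v => le_ciInf_add_ciInf fun l m =>
      (ciInf_le (tensorCost_bddBelow p q (u + v))
        ⟨l.1 ++ m.1, by
          have hl := l.2
          have hm := m.2
          simp only [TensorRep] at *
          simp [hl, hm]⟩).trans (by simp [tensorCost]))
    (fun r u => by
      rw [Real.mul_iInf_of_nonneg (norm_nonneg _)]
      exact le_ciInf fun l =>
        (ciInf_le (tensorCost_bddBelow p q (r • u))
          ⟨_, l.2.smul r⟩).trans (tensorCost_smul p q l.1 r).le)

theorem projectiveTensorSeminorm_apply (p : Seminorm 𝕜 E) (q : Seminorm 𝕜 F) (u : E ⊗[𝕜] F) :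
    projectiveTensorSeminorm p q u =
      ⨅ l : {l : List (E × F) // TensorRep l u}, tensorCost p q l := rfl

theorem projectiveTensorSeminorm_tmul_le (p : Seminorm 𝕜 E) (q : Seminorm 𝕜 F) (x : E) (y : F) :
    projectiveTensorSeminorm p q (x ⊗ₜ[𝕜] y) ≤ p x * q y :=
  (ciInf_le (tensorCost_bddBelow p q _) ⟨[(x, y)], by simp [TensorRep]⟩).trans
    (by simp [tensorCost])

/-- A linear map on `E ⊗ F` is bounded by the projective seminorm as soon as it is so on
elementary tensors. -/
theorem le_projectiveTensorSeminorm (p : Seminorm 𝕜 E) (q : Seminorm 𝕜 F) (r : Seminorm 𝕜 G)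
    (f : E ⊗[𝕜] F →ₗ[𝕜] G) (C : ℝ) (hC : 0 ≤ C)
    (h : ∀ x y, r (f (x ⊗ₜ[𝕜] y)) ≤ C * (p x * q y)) (u : E ⊗[𝕜] F) :
    r (f u) ≤ C * projectiveTensorSeminorm p q u := by
  rw [projectiveTensorSeminorm_apply, Real.mul_iInf_of_nonneg hC]
  refine le_ciInf fun l => ?_
  obtain ⟨l, hl⟩ := l
  induction l generalizing u with
  | nil =>
    have hu : u = 0 := by simpa [TensorRep] using hl.symm
    simp [hu, tensorCost]
  | cons z l ih =>
    have hu : u = z.1 ⊗ₜ[𝕜] z.2 + (l.map fun z => z.1 ⊗ₜ[𝕜] z.2).sum := by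
      simpa [TensorRep] using hl.symm
    have h1 := ih _ rfl
    have h2 := h z.1 z.2
    have h3 := map_add_le_add r (f (z.1 ⊗ₜ[𝕜] z.2)) (f (l.map fun z => z.1 ⊗ₜ[𝕜] z.2).sum)
    refine (congrArg (fun w => r (f w)) hu).le.trans ?_
    simp only [map_add]
    simp only [tensorCost, List.map_cons, List.sum_cons, mul_add] at h1 ⊢
    linarith

end Seminorms

/-! ### Fréchet algebras, ideals, quotients -/

/-- A submultiplicative seminorm on a (not necessarily unital) algebra. -/
structure AlgSeminorm (𝕜 : Type*) [RCLike 𝕜] (A : Type*) [NonUnitalRing A] [Module 𝕜 A]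
    extends Seminorm 𝕜 A where
  mul_le' : ∀ a b : A, toSeminorm (a * b) ≤ toSeminorm a * toSeminorm b

/-- `(A, p)` is a Fréchet algebra: a complete Hausdorff algebra whose topology is given by the
increasing sequence `p` of submultiplicative seminorms. -/
structure IsFrechetAlgebra {𝕜 : Type*} [RCLike 𝕜] {A : Type*} [NonUnitalRing A] [Module 𝕜 A]
    [UniformSpace A] [IsUniformAddGroup A] (p : ℕ → AlgSeminorm 𝕜 A) : Prop where
  complete : CompleteSpace A
  hausdorff : T2Space A
  withSeminorms : WithSeminorms (fun n => (p n).toSeminorm)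
  monotone : Monotone (fun n => (p n).toSeminorm)

/-- The norm of a normed algebra as a submultiplicative seminorm. -/
def normAlgSeminorm (𝕜 : Type*) [RCLike 𝕜] (B : Type*) [NonUnitalNormedRing B]
    [NormedSpace 𝕜 B] : AlgSeminorm 𝕜 B where
  toSeminorm := normSeminorm 𝕜 B
  mul_le' := norm_mul_le

/-- A two-sided ideal of an algebra (a linear subspace absorbing products on both sides). -/
structure AlgIdeal (𝕜 : Type*) [RCLike 𝕜] (A : Type*) [NonUnitalRing A] [Module 𝕜 A]
    extends Submodule 𝕜 A where
  mul_mem_left' : ∀ (a : A) {x : A}, x ∈ toSubmodule → a * x ∈ toSubmodule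
  mul_mem_right' : ∀ (a : A) {x : A}, x ∈ toSubmodule → x * a ∈ toSubmodule

section Diagonal

variable {𝕜 : Type*} [RCLike 𝕜] {A : Type u} [NonUnitalRing A] [Module 𝕜 A]
  [IsScalarTower 𝕜 A A] [SMulCommClass 𝕜 A A]

/-- The quotient space `A / I`. -/
abbrev AlgIdeal.Quot (I : AlgIdeal 𝕜 A) : Type u := A ⧸ I.toSubmodule

/-- The left action `a · (b + I) = ab + I` on `A / I`. -/
def AlgIdeal.lmulQ (I : AlgIdeal 𝕜 A) (a : A) : I.Quot →ₗ[𝕜] I.Quot :=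
  I.toSubmodule.mapQ I.toSubmodule (LinearMap.mulLeft 𝕜 a) fun _ hx => I.mul_mem_left' a hx

/-- The right action `(b + I) · a = ba + I` on `A / I`. -/
def AlgIdeal.rmulQ (I : AlgIdeal 𝕜 A) (a : A) : I.Quot →ₗ[𝕜] I.Quot :=
  I.toSubmodule.mapQ I.toSubmodule (LinearMap.mulRight 𝕜 a) fun _ hx => I.mul_mem_right' a hx

/-- The multiplication `(a + I)(b + I) = ab + I` of `A / I`. -/
def AlgIdeal.mulQ (I : AlgIdeal 𝕜 A) : I.Quot →ₗ[𝕜] I.Quot →ₗ[𝕜] I.Quot :=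
  I.toSubmodule.liftQ
    { toFun := I.lmulQ
      map_add' := fun a b => by
        refine Submodule.linearMap_qext _ (LinearMap.ext fun x => ?_)
        exact congrArg I.toSubmodule.mkQ (add_mul a b x)
      map_smul' := fun r a => by
        refine Submodule.linearMap_qext _ (LinearMap.ext fun x => ?_)
        exact congrArg I.toSubmodule.mkQ (smul_mul_assoc r a x) }
    (fun a ha => by
      rw [LinearMap.mem_ker]
      refine Submodule.linearMap_qext _ (LinearMap.ext fun x => ?_)
      exact (Submodule.Quotient.mk_eq_zero _).2 (I.mul_mem_right' x ha))

theorem AlgIdeal.mulQ_mk (I : AlgIdeal 𝕜 A) (a b : A) :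
    I.mulQ (I.toSubmodule.mkQ a) (I.toSubmodule.mkQ b) = I.toSubmodule.mkQ (a * b) := rfl

variable {ι : Type*} (p : ι → AlgSeminorm 𝕜 A) (I : AlgIdeal 𝕜 A)

/-- The seminorms `p̂ i` on `A / I`. -/
def quotFamily (i : ι) : Seminorm 𝕜 I.Quot :=
  quotientSeminorm (p i).toSeminorm I.toSubmodule

/-- The seminorms `r̂ i` on the algebraic tensor product of `A / I` with itself. -/
def tensorFamily (i : ι) : Seminorm 𝕜 (I.Quot ⊗[𝕜] I.Quot) :=
  projectiveTensorSeminorm (quotFamily p I i) (quotFamily p I i)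

theorem quotFamily_mul_le (i : ι) (x y : I.Quot) :
    quotFamily p I i (I.mulQ x y) ≤ quotFamily p I i x * quotFamily p I i y := by
  simp only [quotFamily, quotientSeminorm_apply (p i).toSeminorm I.toSubmodule x,
    quotientSeminorm_apply (p i).toSeminorm I.toSubmodule y]
  rw [Real.iInf_mul_of_nonneg (Real.iInf_nonneg fun a => apply_nonneg _ _)]
  refine le_ciInf fun a => ?_
  rw [Real.mul_iInf_of_nonneg (apply_nonneg _ _)]
  refine le_ciInf fun b => ?_
  obtain ⟨a, rfl⟩ := a
  obtain ⟨b, rfl⟩ := b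
  exact (quotientSeminorm_mkQ_le _ _ (a * b)).trans ((p i).mul_le' a b)

theorem quotFamily_lmulQ_le (i : ι) (a : A) (x : I.Quot) :
    quotFamily p I i (I.lmulQ a x) ≤ (p i).toSeminorm a * quotFamily p I i x :=
  (quotFamily_mul_le p I i (I.toSubmodule.mkQ a) x).trans
    (mul_le_mul_of_nonneg_right (quotientSeminorm_mkQ_le _ _ _) (apply_nonneg _ _))

theorem quotFamily_rmulQ_le (i : ι) (a : A) (x : I.Quot) :
    quotFamily p I i (I.rmulQ a x) ≤ (p i).toSeminorm a * quotFamily p I i x := by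
  obtain ⟨x, rfl⟩ := I.toSubmodule.mkQ_surjective x
  refine (quotFamily_mul_le p I i (I.toSubmodule.mkQ x) (I.toSubmodule.mkQ a)).trans ?_
  rw [mul_comm]
  exact mul_le_mul_of_nonneg_right (quotientSeminorm_mkQ_le _ _ _) (apply_nonneg _ _)

/-- `A / I` with the topology of the seminorms `p̂ i`, completed. For a Fréchet algebra `A` and a
closed ideal `I` the space `A / I` is already complete and Hausdorff, so this is `A / I` itself. -/
abbrev QuotSpace : Type _ := LCCompletion (quotFamily p I)

/-- The completed projective tensor product of `A / I` with itself. -/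
abbrev ProjTensor : Type _ := LCCompletion (tensorFamily p I)

/-- The seminorm `p̂ i` on `A / I`. -/
def quotNorm (i : ι) : QuotSpace p I → ℝ := LCCompletion.seminorm (quotFamily p I) i

/-- The seminorm `r̂ i` on the completed projective tensor product. -/
def tensorNorm (i : ι) : ProjTensor p I → ℝ := LCCompletion.seminorm (tensorFamily p I) i

/-- The class `ã = a + I`. -/
def tildeClass (a : A) : QuotSpace p I := LCCompletion.of (quotFamily p I) (I.toSubmodule.mkQ a)

/-- The left action of `a` on `A / I`. -/
def quotLeft (a : A) : QuotSpace p I →L[𝕜] QuotSpace p I :=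
  LCCompletion.map (I.lmulQ a) fun i => ⟨i, (p i).toSeminorm a, quotFamily_lmulQ_le p I i a⟩

/-- The left action `a · (x ⊗ y) = ax ⊗ y` on the completed projective tensor product. -/
def tensorLeft (a : A) : ProjTensor p I →L[𝕜] ProjTensor p I :=
  LCCompletion.map (LinearMap.rTensor I.Quot (I.lmulQ a)) fun i =>
    ⟨i, (p i).toSeminorm a, le_projectiveTensorSeminorm _ _ _ _ _ (apply_nonneg _ _) fun x y =>
      (projectiveTensorSeminorm_tmul_le _ _ _ _).trans <| by
        rw [← mul_assoc]
        exact mul_le_mul_of_nonneg_right (quotFamily_lmulQ_le p I i a x) (apply_nonneg _ _)⟩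

/-- The right action `(x ⊗ y) · a = x ⊗ ya` on the completed projective tensor product. -/
def tensorRight (a : A) : ProjTensor p I →L[𝕜] ProjTensor p I :=
  LCCompletion.map (LinearMap.lTensor I.Quot (I.rmulQ a)) fun i =>
    ⟨i, (p i).toSeminorm a, le_projectiveTensorSeminorm _ _ _ _ _ (apply_nonneg _ _) fun x y =>
      (projectiveTensorSeminorm_tmul_le _ _ _ _).trans <| by
        rw [mul_left_comm]
        exact mul_le_mul_of_nonneg_left (quotFamily_rmulQ_le p I i a y) (apply_nonneg _ _)⟩

/-- The diagonal operator `π (x ⊗ y) = xy`. -/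
def diagonalOp : ProjTensor p I →L[𝕜] QuotSpace p I :=
  LCCompletion.map (TensorProduct.lift I.mulQ) fun i =>
    ⟨i, 1, le_projectiveTensorSeminorm _ _ _ _ _ zero_le_one fun x y => by
      simpa using quotFamily_mul_le p I i x y⟩

/-- Locally bounded approximate diagonal modulo `I` for `(A, p)`. -/
def HasLocallyBoundedApproxDiagonal : Prop :=
  ∃ C : ι → ℝ, (∀ i, 0 < C i) ∧
    ∀ F : Finset A, (∀ a ∈ F, a ∉ I.toSubmodule) → ∀ i, ∀ ε : ℝ, 0 < ε →
      ∃ M : ProjTensor p I, tensorNorm p I i M ≤ C i ∧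
        (∀ a ∈ F, tensorNorm p I i (tensorLeft p I a M - tensorRight p I a M) < ε) ∧
        (∀ a ∈ F, quotNorm p I i (quotLeft p I a (diagonalOp p I M) - tildeClass p I a) < ε)

/-- Bounded approximate diagonal modulo `I` for `(A, p)`: a net in the completed projective tensor
product, bounded for every seminorm, with the two limit properties. -/
def HasBoundedApproxDiagonal : Prop :=
  ∃ (Λ : Type u) (_ : Preorder Λ) (_ : IsDirectedOrder Λ) (_ : Nonempty Λ)
    (m : Λ → ProjTensor p I),
    (∀ i, ∃ C : ℝ, ∀ α, tensorNorm p I i (m α) ≤ C) ∧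
    (∀ a : A, Tendsto (fun α => quotLeft p I a (diagonalOp p I (m α)) - tildeClass p I a)
      atTop (𝓝 0)) ∧
    (∀ a : A, a ∉ I.toSubmodule →
      Tendsto (fun α => tensorLeft p I a (m α) - tensorRight p I a (m α)) atTop (𝓝 0))

end Diagonal

/-- Bounded approximate diagonal modulo `J` for a Banach algebra `B`, i.e. for the topology of the
single seminorm given by the norm of `B`. -/
def BanachHasBoundedApproxDiagonal {𝕜 : Type*} [RCLike 𝕜] {B : Type u} [NonUnitalNormedRing B]
    [NormedSpace 𝕜 B] [IsScalarTower 𝕜 B B] [SMulCommClass 𝕜 B B] (J : AlgIdeal 𝕜 B) : Prop :=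
  HasBoundedApproxDiagonal (fun _ : Unit => normAlgSeminorm 𝕜 B) J

/-! ### Arens–Michael decompositions -/

/-- The closure of the image of an ideal under a homomorphism with dense range. -/
def AlgIdeal.mapClosure {𝕜 : Type*} [RCLike 𝕜] {A : Type*} [NonUnitalRing A] [Module 𝕜 A]
    {B : Type*} [NonUnitalNormedRing B] [NormedSpace 𝕜 B]
    (I : AlgIdeal 𝕜 A) (f : A →ₙₐ[𝕜] B) (hf : DenseRange f) : AlgIdeal 𝕜 B where
  toSubmodule := (I.toSubmodule.map (f : A →ₗ[𝕜] B)).topologicalClosure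
  mul_mem_left' := by
    intro b x hx
    have key : ∀ a : A, f a * x ∈ closure (I.toSubmodule.map (f : A →ₗ[𝕜] B) : Set B) := fun a =>
      map_mem_closure (f := fun y => f a * y) (by fun_prop) hx <| by
        rintro _ ⟨y, hy, rfl⟩
        exact ⟨a * y, I.mul_mem_left' a hy, map_mul f a y⟩
    exact hf.induction_on (p := fun b => b * x ∈
      closure (I.toSubmodule.map (f : A →ₗ[𝕜] B) : Set B)) b
      (isClosed_closure.preimage (by fun_prop)) key
  mul_mem_right' := by
    intro b x hx
    have key : ∀ a : A, x * f a ∈ closure (I.toSubmodule.map (f : A →ₗ[𝕜] B) : Set B) := fun a =>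
      map_mem_closure (f := fun y => y * f a) (by fun_prop) hx <| by
        rintro _ ⟨y, hy, rfl⟩
        exact ⟨y * a, I.mul_mem_right' a hy, map_mul f y a⟩
    exact hf.induction_on (p := fun b => x * b ∈
      closure (I.toSubmodule.map (f : A →ₗ[𝕜] B) : Set B)) b
      (isClosed_closure.preimage (by fun_prop)) key

/-- An Arens–Michael decomposition `A = lim (B n, link n)` of a topological algebra `A` as a reduced
inverse limit of a sequence of Banach algebras: `a ↦ (proj n a)` is a topological isomorphism of `A`
onto the inverse limit, and each `proj n` has dense range. -/
structure ArensMichaelDecomposition (𝕜 : Type*) [RCLike 𝕜] (A : Type*) [NonUnitalRing A]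
    [Module 𝕜 A] [TopologicalSpace A] (B : ℕ → Type v) [∀ n, NonUnitalNormedRing (B n)]
    [∀ n, NormedSpace 𝕜 (B n)] where
  complete : ∀ n, CompleteSpace (B n)
  link : ∀ n, B (n + 1) →ₙₐ[𝕜] B n
  continuous_link : ∀ n, Continuous (link n)
  proj : ∀ n, A →ₙₐ[𝕜] B n
  denseRange_proj : ∀ n, DenseRange (proj n)
  isEmbedding_proj : IsEmbedding fun (a : A) (n : ℕ) => proj n a
  range_proj : Set.range (fun (a : A) (n : ℕ) => proj n a) =
    {x : ∀ n, B n | ∀ n, link n (x (n + 1)) = x n}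

/-- The closure in `B n` of the image `I_n` of the ideal `I` of `A`. -/
def ArensMichaelDecomposition.idealClosure {𝕜 : Type*} [RCLike 𝕜] {A : Type*} [NonUnitalRing A]
    [Module 𝕜 A] [TopologicalSpace A] {B : ℕ → Type v} [∀ n, NonUnitalNormedRing (B n)]
    [∀ n, NormedSpace 𝕜 (B n)] (D : ArensMichaelDecomposition 𝕜 A B) (I : AlgIdeal 𝕜 A) (n : ℕ) :
    AlgIdeal 𝕜 (B n) :=
  I.mapClosure (D.proj n) (D.denseRange_proj n)

end

/-! Both properties reduce to one condition on a single seminorm, `HasAlgebraicApproxDiagonal`, and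
the theorem becomes a transfer principle for that condition along the maps `D.proj n`.

The reduction rests on two facts. The estimates at index `n` involve only the `n`-th seminorm, with
a bound independent of the finite set and of `ε`, so a small perturbation moves the approximants
into the algebraic tensor product. Elements of the ideal act as zero on the quotient, so finite sets
may contain them. In the Banach case, finite sets paired with tolerances index a net.

Continuity and the embedding property of the decomposition give, for each `n`, some `m` with
`‖D.proj n a‖ ≤ K * p m a`, and also some `m` with `p n a ≤ K * ‖D.proj m a‖`. The first estimate
pushes approximate diagonals from `A` to `B n` (`HasAlgebraicApproxDiagonal.push`), by density of
the range. The second pulls them back from `B m` (`HasAlgebraicApproxDiagonal.pull`). No two-sided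
estimate at one level is needed.

The delicate point is the pullback: an image tensor may have cheaper representations downstairs,
with factors outside the image. `projectiveTensorSeminorm_le_map` shows that density of the image
makes this harmless up to the factor `K ^ 2`. -/

noncomputable section

set_option linter.unusedSectionVars false

/-! ### Seminorm estimates on completions. -/

section Completion

variable {𝕜 : Type*} [RCLike 𝕜] {ι κ : Type*} {E F : Type*} [AddCommGroup E] [Module 𝕜 E]
  [AddCommGroup F] [Module 𝕜 F] (p : ι → Seminorm 𝕜 E) (q : κ → Seminorm 𝕜 F)

theorem LCCompletion.denseRange_of : DenseRange (LCCompletion.of p) :=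
  UniformSpace.Completion.denseRange_coe (α := SeminormedBy p)

theorem LCCompletion.of_sub (x y : E) :
    LCCompletion.of p (x - y) = LCCompletion.of p x - LCCompletion.of p y :=
  UniformSpace.Completion.coe_sub (α := SeminormedBy p) x y

theorem LCCompletion.of_zero : LCCompletion.of p 0 = 0 :=
  UniformSpace.Completion.coe_zero (α := SeminormedBy p)

theorem LCCompletion.seminorm_zero (i : ι) : LCCompletion.seminorm p i 0 = 0 := by
  rw [← LCCompletion.of_zero p, LCCompletion.seminorm_of, map_zero]

/-- Subadditivity is a closed condition, so density suffices. Taking `x = y` also yields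
nonnegativity of the extended seminorm. -/
theorem LCCompletion.seminorm_sub_le (i : ι) (x y : LCCompletion p) :
    LCCompletion.seminorm p i (x - y) ≤ LCCompletion.seminorm p i x + LCCompletion.seminorm p i y := by
  have hc := LCCompletion.continuous_seminorm p i
  refine (LCCompletion.denseRange_of p).induction_on₂
    (p := fun x y => LCCompletion.seminorm p i (x - y) ≤
      LCCompletion.seminorm p i x + LCCompletion.seminorm p i y) ?_ ?_ x y
  · exact isClosed_le (by fun_prop) (by fun_prop)
  · intro a b
    rw [← LCCompletion.of_sub]
    simp only [LCCompletion.seminorm_of]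
    exact map_sub_le_add (p i) a b

theorem LCCompletion.exists_seminorm_sub_of_lt (i : ι) (x : LCCompletion p) {ε : ℝ} (hε : 0 < ε) :
    ∃ a, LCCompletion.seminorm p i (x - LCCompletion.of p a) < ε := by
  have hc := LCCompletion.continuous_seminorm p i
  refine (LCCompletion.denseRange_of p).exists_mem_open
    (s := {y | LCCompletion.seminorm p i (x - y) < ε})
    (isOpen_lt (by fun_prop) continuous_const) ⟨x, ?_⟩
  simpa [LCCompletion.seminorm_zero] using hε

variable {p q}

/-- A continuous map of completions that restricts to a seminorm-bounded linear map stays bounded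
by the same constant. -/
theorem LCCompletion.seminorm_le_of_restrict (T : LCCompletion p →L[𝕜] LCCompletion q)
    (f : E →ₗ[𝕜] F) (hT : ∀ x, T (LCCompletion.of p x) = LCCompletion.of q (f x)) {i : ι} {j : κ}
    {C : ℝ} (h : ∀ x, q j (f x) ≤ C * p i x) (x : LCCompletion p) :
    LCCompletion.seminorm q j (T x) ≤ C * LCCompletion.seminorm p i x := by
  have hc := LCCompletion.continuous_seminorm p i
  have hd := LCCompletion.continuous_seminorm q j
  refine (LCCompletion.denseRange_of p).induction_on
    (p := fun x => LCCompletion.seminorm q j (T x) ≤ C * LCCompletion.seminorm p i x) x ?_ ?_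
  · exact isClosed_le (by fun_prop) (by fun_prop)
  · intro a
    simpa only [hT, LCCompletion.seminorm_of] using h a

/-- Neighbourhoods of `0` for an infimum of topologies are the infimum of the neighbourhood filters,
so convergence is tested one seminorm at a time. -/
theorem LCCompletion.tendsto_of_zero {Λ : Type*} {l : Filter Λ} {x : Λ → E}
    (h : ∀ i, Tendsto (fun α => p i (x α)) l (𝓝 0)) :
    Tendsto (fun α => LCCompletion.of p (x α)) l (𝓝 0) := by
  rw [← LCCompletion.of_zero p]
  refine ((UniformSpace.Completion.continuous_coe (SeminormedBy p)).tendsto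
    (0 : SeminormedBy p)).comp ?_
  have ht : @nhds E (inferInstanceAs (TopologicalSpace (SeminormedBy p))) 0 = ⨅ i, @nhds E
      ((p i).toAddGroupSeminorm.toSeminormedAddCommGroup).toUniformSpace.toTopologicalSpace 0 :=
    (congrArg (fun t => @nhds E t 0) UniformSpace.toTopologicalSpace_iInf).trans nhds_iInf
  refine Tendsto.mono_right (tendsto_iInf.2 fun i => ?_) ht.ge
  exact (@tendsto_zero_iff_norm_tendsto_zero _ _
    (p i).toAddGroupSeminorm.toSeminormedAddCommGroup.toSeminormedAddGroup _ _).2 (h i)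

end Completion

/-! ### Projective tensor seminorms and dense subspaces. -/

section DenseTensor

variable {𝕜 : Type*} [RCLike 𝕜] {E F G : Type*} [AddCommGroup E] [Module 𝕜 E]
  [AddCommGroup F] [Module 𝕜 F] [AddCommGroup G] [Module 𝕜 G]

/-- A bilinear map on `E` that is bounded in terms of a linear map `ψ` of `E` onto a dense subspace
of a seminormed space `F` extends to a bounded bilinear map on `F`. -/
theorem exists_bilinear_extension {E F X : Type*} [AddCommGroup E] [Module 𝕜 E]
    [SeminormedAddCommGroup F] [NormedSpace 𝕜 F] [NormedAddCommGroup X] [NormedSpace 𝕜 X]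
    [CompleteSpace X] (ψ : E →ₗ[𝕜] F) (hψ : DenseRange ψ) (β : E →ₗ[𝕜] E →ₗ[𝕜] X) {C : ℝ}
    (h : ∀ x y, ‖β x y‖ ≤ C * ‖ψ x‖ * ‖ψ y‖) :
    ∃ γ : F →L[𝕜] F →L[𝕜] X, (∀ x y, ‖γ x y‖ ≤ C * (‖x‖ * ‖y‖)) ∧
      ∀ x y, γ (ψ x) (ψ y) = β x y := by
  -- With the seminorm pulled back along `ψ`, the map becomes isometric, and bounded maps on `E`
  -- extend to `F`.
  let _ : SeminormedAddCommGroup E := SeminormedAddCommGroup.induced E F ψ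
  let _ : NormedSpace 𝕜 E := NormedSpace.induced 𝕜 E F ψ
  have hnorm : ∀ x : E, ‖ψ x‖ = ‖x‖ := fun x => rfl
  let Ψ : E →L[𝕜] F := ψ.mkContinuous 1 fun x => by rw [hnorm, one_mul]
  have hΨ : IsUniformInducing Ψ := (AddMonoidHomClass.isometry_of_norm Ψ hnorm).isUniformInducing
  have hΨd : DenseRange Ψ := hψ
  -- The extension is made one variable at a time; `flip` exposes the second variable and then
  -- restores the order.
  let β₁ : E →L[𝕜] E →L[𝕜] X := β.mkContinuous₂ C h
  let β₂ : E →L[𝕜] F →L[𝕜] X := (β₁.extend Ψ).flip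
  let γ : F →L[𝕜] F →L[𝕜] X := (β₂.extend Ψ).flip
  have hγ : ∀ x y, γ (ψ x) (ψ y) = β x y := fun x y => by
    change (β₂.extend Ψ) (Ψ y) (Ψ x) = _
    rw [ContinuousLinearMap.extend_eq _ hΨd hΨ]
    change (β₁.extend Ψ) (Ψ x) y = _
    rw [ContinuousLinearMap.extend_eq _ hΨd hΨ]
    rfl
  refine ⟨γ, fun x y => ?_, hγ⟩
  refine hψ.induction_on₂ (p := fun x y => ‖γ x y‖ ≤ C * (‖x‖ * ‖y‖)) ?_ ?_ x y
  · exact isClosed_le (by fun_prop) (by fun_prop)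
  · intro a b
    rw [hγ, ← mul_assoc]
    exact h a b

/-- The projective tensor seminorm respects dense subspaces. -/
theorem projectiveTensorSeminorm_le_map (p : Seminorm 𝕜 E) (q : Seminorm 𝕜 F) (ψ : E →ₗ[𝕜] F)
    (hψ : ∀ y, ∀ ε > 0, ∃ x, q (y - ψ x) < ε) {K : ℝ} (hK : 0 ≤ K)
    (h : ∀ x, p x ≤ K * q (ψ x)) (u : E ⊗[𝕜] E) :
    projectiveTensorSeminorm p p u ≤
      K ^ 2 * projectiveTensorSeminorm q q (TensorProduct.map ψ ψ u) := by
  let _ : SeminormedAddCommGroup F := q.toAddGroupSeminorm.toSeminormedAddCommGroup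
  let _ : NormedSpace 𝕜 F := ⟨fun c x => (map_smul_eq_mul q c x).le⟩
  let r := projectiveTensorSeminorm p p
  let _ : SeminormedAddCommGroup (E ⊗[𝕜] E) := r.toAddGroupSeminorm.toSeminormedAddCommGroup
  let _ : NormedSpace 𝕜 (E ⊗[𝕜] E) := ⟨fun c x => (map_smul_eq_mul r c x).le⟩
  have hd : DenseRange ψ := fun y => Metric.mem_closure_range_iff.2 fun ε hε => by
    obtain ⟨x, hx⟩ := hψ y ε hε
    exact ⟨x, by rw [dist_eq_norm]; exact hx⟩
  -- The completion supplies a complete normed target into which `E ⊗ E` maps seminorm-preservingly.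
  let j : E ⊗[𝕜] E →ₗ[𝕜] UniformSpace.Completion (E ⊗[𝕜] E) :=
    (UniformSpace.Completion.toComplL (𝕜 := 𝕜) (E := E ⊗[𝕜] E)).toLinearMap
  have hj : ∀ u, ‖j u‖ = r u := fun u => UniformSpace.Completion.norm_coe u
  obtain ⟨γ, hγ, hγj⟩ := exists_bilinear_extension ψ hd ((TensorProduct.mk 𝕜 E E).compr₂ j)
    (C := K ^ 2) fun x y => by
      change ‖j (x ⊗ₜ y)‖ ≤ _
      rw [hj]
      refine (projectiveTensorSeminorm_tmul_le p p x y).trans ?_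
      refine (mul_le_mul (h x) (h y) (apply_nonneg _ _)
        (mul_nonneg hK (apply_nonneg _ _))).trans_eq ?_
      change _ = K ^ 2 * q (ψ x) * q (ψ y)
      ring
  let Γ : F ⊗[𝕜] F →ₗ[𝕜] UniformSpace.Completion (E ⊗[𝕜] E) :=
    TensorProduct.lift
      (LinearMap.mk₂ 𝕜 (fun x y => γ x y) (by simp) (by simp) (by simp) (by simp))
  -- Thus `r u` is the norm of `Γ` at the image tensor, and any representation of that image in `F ⊗
  -- F` bounds it.
  have hΓ : Γ ∘ₗ TensorProduct.map ψ ψ = j := TensorProduct.ext' fun x y => by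
    simpa [Γ] using hγj x y
  have := le_projectiveTensorSeminorm q q (normSeminorm 𝕜 _) Γ (K ^ 2) (by positivity)
    hγ (TensorProduct.map ψ ψ u)
  change r u ≤ _
  rw [← hj, ← hΓ]
  exact this

end DenseTensor

/-! ### Reduction of both properties to algebraic tensors. -/

section Algebraic

variable {𝕜 : Type*} [RCLike 𝕜] {A : Type u} [NonUnitalRing A] [Module 𝕜 A]
  [IsScalarTower 𝕜 A A] [SMulCommClass 𝕜 A A]

/-- The commutator `a · N - N · a` on the algebraic tensor product of `A / I` with itself. -/
def AlgIdeal.tensorCommutator (I : AlgIdeal 𝕜 A) (a : A) :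
    I.Quot ⊗[𝕜] I.Quot →ₗ[𝕜] I.Quot ⊗[𝕜] I.Quot :=
  LinearMap.rTensor I.Quot (I.lmulQ a) - LinearMap.lTensor I.Quot (I.rmulQ a)

/-- The element `a · π (N) - (a + I)` of `A / I`. -/
def AlgIdeal.unitDefect (I : AlgIdeal 𝕜 A) (a : A) (N : I.Quot ⊗[𝕜] I.Quot) : I.Quot :=
  I.lmulQ a (TensorProduct.lift I.mulQ N) - I.toSubmodule.mkQ a

theorem AlgIdeal.lmulQ_add (I : AlgIdeal 𝕜 A) (a b : A) : I.lmulQ (a + b) = I.lmulQ a + I.lmulQ b :=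
  Submodule.linearMap_qext _ <| LinearMap.ext fun x =>
    congrArg I.toSubmodule.mkQ (add_mul a b x)

theorem AlgIdeal.rmulQ_add (I : AlgIdeal 𝕜 A) (a b : A) : I.rmulQ (a + b) = I.rmulQ a + I.rmulQ b :=
  Submodule.linearMap_qext _ <| LinearMap.ext fun x =>
    congrArg I.toSubmodule.mkQ (mul_add x a b)

/-- Additivity in the acting element lets an element be replaced by a nearby one in a dense range at
the cost of a small error term. -/
theorem AlgIdeal.tensorCommutator_add (I : AlgIdeal 𝕜 A) (a b : A) (N : I.Quot ⊗[𝕜] I.Quot) :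
    I.tensorCommutator (a + b) N = I.tensorCommutator a N + I.tensorCommutator b N := by
  simp only [AlgIdeal.tensorCommutator, I.lmulQ_add, I.rmulQ_add, LinearMap.rTensor_add,
    LinearMap.lTensor_add, LinearMap.sub_apply, LinearMap.add_apply]
  abel

theorem AlgIdeal.unitDefect_add (I : AlgIdeal 𝕜 A) (a b : A) (N : I.Quot ⊗[𝕜] I.Quot) :
    I.unitDefect (a + b) N = I.unitDefect a N + I.unitDefect b N := by
  simp only [AlgIdeal.unitDefect, I.lmulQ_add, map_add, LinearMap.add_apply]
  abel

theorem AlgIdeal.lmulQ_of_mem (I : AlgIdeal 𝕜 A) {a : A} (ha : a ∈ I.toSubmodule) :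
    I.lmulQ a = 0 :=
  Submodule.linearMap_qext _ <| LinearMap.ext fun x =>
    (Submodule.Quotient.mk_eq_zero _).2 (I.mul_mem_right' x ha)

theorem AlgIdeal.rmulQ_of_mem (I : AlgIdeal 𝕜 A) {a : A} (ha : a ∈ I.toSubmodule) :
    I.rmulQ a = 0 :=
  Submodule.linearMap_qext _ <| LinearMap.ext fun x =>
    (Submodule.Quotient.mk_eq_zero _).2 (I.mul_mem_left' x ha)

/-- Both actions of an element of `I` vanish on `A / I`; hence excluding such elements from finite
sets loses nothing. -/
theorem AlgIdeal.tensorCommutator_of_mem (I : AlgIdeal 𝕜 A) {a : A} (ha : a ∈ I.toSubmodule)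
    (N : I.Quot ⊗[𝕜] I.Quot) : I.tensorCommutator a N = 0 := by
  simp [AlgIdeal.tensorCommutator, I.lmulQ_of_mem ha, I.rmulQ_of_mem ha]

theorem AlgIdeal.unitDefect_of_mem (I : AlgIdeal 𝕜 A) {a : A} (ha : a ∈ I.toSubmodule)
    (N : I.Quot ⊗[𝕜] I.Quot) : I.unitDefect a N = 0 := by
  simpa [AlgIdeal.unitDefect, I.lmulQ_of_mem ha] using ha

section Bounds

variable {ι : Type*} (p : ι → AlgSeminorm 𝕜 A) (I : AlgIdeal 𝕜 A) (i : ι)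

theorem tensorFamily_commutator_le (a : A) (N : I.Quot ⊗[𝕜] I.Quot) :
    tensorFamily p I i (I.tensorCommutator a N) ≤
      2 * (p i).toSeminorm a * tensorFamily p I i N := by
  refine le_projectiveTensorSeminorm _ _ _ _ _ (mul_nonneg zero_le_two (apply_nonneg _ _))
    (fun x y => ?_) N
  refine (map_sub_le_add (tensorFamily p I i) (I.lmulQ a x ⊗ₜ y) (x ⊗ₜ I.rmulQ a y)).trans ?_
  have h1 := (projectiveTensorSeminorm_tmul_le (quotFamily p I i) (quotFamily p I i)
    (I.lmulQ a x) y).trans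
    (mul_le_mul_of_nonneg_right (quotFamily_lmulQ_le p I i a x) (apply_nonneg _ _))
  have h2 := (projectiveTensorSeminorm_tmul_le (quotFamily p I i) (quotFamily p I i)
    x (I.rmulQ a y)).trans
    (mul_le_mul_of_nonneg_left (quotFamily_rmulQ_le p I i a y) (apply_nonneg _ _))
  refine (add_le_add h1 h2).trans_eq ?_
  ring

theorem quotFamily_lift_mulQ_le (N : I.Quot ⊗[𝕜] I.Quot) :
    quotFamily p I i (TensorProduct.lift I.mulQ N) ≤ tensorFamily p I i N := by
  have := le_projectiveTensorSeminorm (quotFamily p I i) (quotFamily p I i) (quotFamily p I i)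
    (TensorProduct.lift I.mulQ) 1 zero_le_one
    (fun x y => by simpa using quotFamily_mul_le p I i x y) N
  rw [one_mul] at this
  exact this

theorem quotFamily_lmulQ_lift_mulQ_le (a : A) (N : I.Quot ⊗[𝕜] I.Quot) :
    quotFamily p I i (I.lmulQ a (TensorProduct.lift I.mulQ N)) ≤
      (p i).toSeminorm a * tensorFamily p I i N :=
  (quotFamily_lmulQ_le p I i a _).trans
    (mul_le_mul_of_nonneg_left (quotFamily_lift_mulQ_le p I i N) (apply_nonneg _ _))

theorem quotFamily_unitDefect_le (a : A) (N : I.Quot ⊗[𝕜] I.Quot) :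
    quotFamily p I i (I.unitDefect a N) ≤ (p i).toSeminorm a * (tensorFamily p I i N + 1) := by
  refine (map_sub_le_add (quotFamily p I i) _ _).trans ?_
  rw [mul_add, mul_one]
  exact add_le_add (quotFamily_lmulQ_lift_mulQ_le p I i a N) (quotientSeminorm_mkQ_le _ _ _)

/-- A bounded approximate diagonal modulo `I` for the single seminorm `p i`, formed in the algebraic
tensor product of `A / I` with itself. -/
def HasAlgebraicApproxDiagonal : Prop :=
  ∃ C : ℝ, 0 < C ∧ ∀ F : Finset A, ∀ ε : ℝ, 0 < ε → ∃ N : I.Quot ⊗[𝕜] I.Quot,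
    tensorFamily p I i N ≤ C ∧ ∀ a ∈ F, tensorFamily p I i (I.tensorCommutator a N) < ε ∧
      quotFamily p I i (I.unitDefect a N) < ε

theorem tensorLeft_sub_tensorRight_of (a : A) (N : I.Quot ⊗[𝕜] I.Quot) :
    tensorLeft p I a (LCCompletion.of _ N) - tensorRight p I a (LCCompletion.of _ N) =
      LCCompletion.of (tensorFamily p I) (I.tensorCommutator a N) := by
  rw [tensorLeft, tensorRight, LCCompletion.map_of, LCCompletion.map_of, ← LCCompletion.of_sub]
  rfl

theorem quotLeft_diagonalOp_of (a : A) (N : I.Quot ⊗[𝕜] I.Quot) :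
    quotLeft p I a (diagonalOp p I (LCCompletion.of _ N)) - tildeClass p I a =
      LCCompletion.of (quotFamily p I) (I.unitDefect a N) := by
  rw [quotLeft, diagonalOp, tildeClass, LCCompletion.map_of, LCCompletion.map_of,
    ← LCCompletion.of_sub]
  rfl

theorem tensorNorm_commutator_le (a : A) (M : ProjTensor p I) :
    tensorNorm p I i (tensorLeft p I a M - tensorRight p I a M) ≤
      2 * (p i).toSeminorm a * tensorNorm p I i M :=
  LCCompletion.seminorm_le_of_restrict (tensorLeft p I a - tensorRight p I a)
    (I.tensorCommutator a) (tensorLeft_sub_tensorRight_of p I a)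
    (tensorFamily_commutator_le p I i a) M

theorem quotNorm_quotLeft_diagonalOp_le (a : A) (M : ProjTensor p I) :
    quotNorm p I i (quotLeft p I a (diagonalOp p I M)) ≤
      (p i).toSeminorm a * tensorNorm p I i M := by
  refine LCCompletion.seminorm_le_of_restrict ((quotLeft p I a).comp (diagonalOp p I))
    (I.lmulQ a ∘ₗ TensorProduct.lift I.mulQ) (fun N => ?_)
    (quotFamily_lmulQ_lift_mulQ_le p I i a) M
  rw [ContinuousLinearMap.comp_apply, quotLeft, diagonalOp, LCCompletion.map_of,
    LCCompletion.map_of]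
  rfl

/-- An approximate diagonal in the completed tensor product, for elements outside the ideal,
can be replaced by one in the algebraic tensor product. -/
theorem hasAlgebraicApproxDiagonal_of_completed {C : ℝ} (hC : 0 ≤ C)
    (h : ∀ F : Finset A, (∀ a ∈ F, a ∉ I.toSubmodule) → ∀ ε : ℝ, 0 < ε →
      ∃ M : ProjTensor p I, tensorNorm p I i M ≤ C ∧
        (∀ a ∈ F, tensorNorm p I i (tensorLeft p I a M - tensorRight p I a M) < ε) ∧
        (∀ a ∈ F, quotNorm p I i (quotLeft p I a (diagonalOp p I M) - tildeClass p I a) < ε)) :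
    HasAlgebraicApproxDiagonal p I i := by
  classical
  refine ⟨C + 1, by linarith, fun F ε hε => ?_⟩
  obtain ⟨M, hM, hM₁, hM₂⟩ := h (F.filter fun a => a ∉ I.toSubmodule)
    (fun a ha => (Finset.mem_filter.1 ha).2) (ε / 2) (half_pos hε)
  obtain ⟨R, hR⟩ : ∃ R, ∀ a ∈ F, (p i).toSeminorm a ≤ R := by
    obtain ⟨R, hR⟩ := (F.image fun a => (p i).toSeminorm a).bddAbove
    exact ⟨R, fun a ha => hR (Finset.mem_coe.2 (Finset.mem_image_of_mem _ ha))⟩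
  -- Chosen so that the perturbation, at most `2 * R` times the distance from `M` to `N`, stays
  -- below `ε / 2`.
  set S := 4 * (|R| + 1) with hS
  have hSpos : 0 < S := by positivity
  obtain ⟨N, hN⟩ := LCCompletion.exists_seminorm_sub_of_lt (tensorFamily p I) i M
    (ε := min 1 (ε / S)) (lt_min one_pos (div_pos hε hSpos))
  have hN₁ := hN.trans_le (min_le_left _ _)
  have hN₂ := (lt_div_iff₀ hSpos).1 (hN.trans_le (min_le_right _ _))
  refine ⟨N, ?_, fun a ha => ?_⟩
  · have := LCCompletion.seminorm_sub_le (tensorFamily p I) i M (M - LCCompletion.of _ N)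
    rw [sub_sub_cancel, LCCompletion.seminorm_of] at this
    exact this.trans (add_le_add hM hN₁.le)
  by_cases haI : a ∈ I.toSubmodule
  · simpa [I.tensorCommutator_of_mem haI, I.unitDefect_of_mem haI] using hε
  have haF : a ∈ F.filter fun a => a ∉ I.toSubmodule := Finset.mem_filter.2 ⟨ha, haI⟩
  have hpa : (p i).toSeminorm a ≤ |R| := (hR a ha).trans (le_abs_self R)
  have hd : 0 ≤ tensorNorm p I i (M - LCCompletion.of _ N) := by
    have h0 := LCCompletion.seminorm_sub_le (tensorFamily p I) i (M - LCCompletion.of _ N)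
      (M - LCCompletion.of _ N)
    rw [sub_self, LCCompletion.seminorm_zero] at h0
    change 0 ≤ LCCompletion.seminorm (tensorFamily p I) i (M - LCCompletion.of _ N)
    linarith
  have hprod := mul_le_mul_of_nonneg_right hpa hd
  change tensorNorm p I i (M - LCCompletion.of _ N) * S < ε at hN₂
  constructor
  · have h1 := LCCompletion.seminorm_sub_le (tensorFamily p I) i
      (tensorLeft p I a M - tensorRight p I a M)
      (tensorLeft p I a (M - LCCompletion.of _ N) - tensorRight p I a (M - LCCompletion.of _ N))
    have h2 := tensorNorm_commutator_le p I i a (M - LCCompletion.of _ N)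
    have h3 := hM₁ a haF
    have h4 : tensorLeft p I a M - tensorRight p I a M -
        (tensorLeft p I a (M - LCCompletion.of _ N) - tensorRight p I a (M - LCCompletion.of _ N)) =
        LCCompletion.of (tensorFamily p I) (I.tensorCommutator a N) := by
      rw [← tensorLeft_sub_tensorRight_of, map_sub, map_sub]
      abel
    rw [h4, LCCompletion.seminorm_of] at h1
    simp only [tensorNorm] at *
    nlinarith
  · have h1 := LCCompletion.seminorm_sub_le (quotFamily p I) i
      (quotLeft p I a (diagonalOp p I M) - tildeClass p I a)
      (quotLeft p I a (diagonalOp p I (M - LCCompletion.of _ N)))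
    have h2 := quotNorm_quotLeft_diagonalOp_le p I i a (M - LCCompletion.of _ N)
    have h3 := hM₂ a haF
    have h4 : quotLeft p I a (diagonalOp p I M) - tildeClass p I a -
        quotLeft p I a (diagonalOp p I (M - LCCompletion.of _ N)) =
        LCCompletion.of (quotFamily p I) (I.unitDefect a N) := by
      rw [← quotLeft_diagonalOp_of, map_sub, map_sub]
      abel
    rw [h4, LCCompletion.seminorm_of] at h1
    simp only [tensorNorm, quotNorm] at *
    nlinarith

end Bounds

/-- `M` may depend on the index, so the indices decouple and the constants `C i` are chosen
separately. -/
theorem hasLocallyBoundedApproxDiagonal_iff {ι : Type*} (p : ι → AlgSeminorm 𝕜 A)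
    (I : AlgIdeal 𝕜 A) :
    HasLocallyBoundedApproxDiagonal p I ↔ ∀ i, HasAlgebraicApproxDiagonal p I i := by
  constructor
  · rintro ⟨C, hC, h⟩ i
    exact hasAlgebraicApproxDiagonal_of_completed p I i (hC i).le fun F hF => h F hF i
  · intro h
    choose C hC h using h
    refine ⟨C, hC, fun F _ i ε hε => ?_⟩
    obtain ⟨N, hN, hN'⟩ := h i F ε hε
    refine ⟨LCCompletion.of _ N, ?_, fun a ha => ?_, fun a ha => ?_⟩
    · rwa [tensorNorm, LCCompletion.seminorm_of]
    · rw [tensorLeft_sub_tensorRight_of, tensorNorm, LCCompletion.seminorm_of]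
      exact (hN' a ha).1
    · rw [quotLeft_diagonalOp_of, quotNorm, LCCompletion.seminorm_of]
      exact (hN' a ha).2

theorem hasBoundedApproxDiagonal_iff (p : Unit → AlgSeminorm 𝕜 A) (I : AlgIdeal 𝕜 A) :
    HasBoundedApproxDiagonal p I ↔ HasAlgebraicApproxDiagonal p I () := by
  constructor
  · rintro ⟨Λ, _, _, _, m, hm, h₁, h₂⟩
    obtain ⟨C, hC⟩ := hm ()
    refine hasAlgebraicApproxDiagonal_of_completed p I () (abs_nonneg C) fun F hF ε hε => ?_
    have e₁ : ∀ᶠ α in atTop, ∀ a ∈ F,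
        tensorNorm p I () (tensorLeft p I a (m α) - tensorRight p I a (m α)) < ε := by
      refine F.eventually_all.2 fun a ha => ?_
      have := ((LCCompletion.continuous_seminorm (tensorFamily p I) ()).tendsto 0).comp
        (h₂ a (hF a ha))
      rw [LCCompletion.seminorm_zero] at this
      exact this.eventually_lt_const hε
    have e₂ : ∀ᶠ α in atTop, ∀ a ∈ F,
        quotNorm p I () (quotLeft p I a (diagonalOp p I (m α)) - tildeClass p I a) < ε := by
      refine F.eventually_all.2 fun a _ => ?_
      have := ((LCCompletion.continuous_seminorm (quotFamily p I) ()).tendsto 0).comp (h₁ a)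
      rw [LCCompletion.seminorm_zero] at this
      exact this.eventually_lt_const hε
    obtain ⟨α, hα⟩ := (e₁.and e₂).exists
    exact ⟨m α, (hC α).trans (le_abs_self C), hα⟩
  · classical
    rintro ⟨C, hC, h⟩
    -- The net is indexed by a finite set and a natural number `k`, with tolerance `1 / (k + 1)`;
    -- each `a` is controlled from `({a}, 0)` on.
    choose N hN hN' using fun α : Finset A × ℕ => h α.1 (1 / (α.2 + 1)) Nat.one_div_pos_of_nat
    have key : ∀ (a : A) (s : Finset A × ℕ → ℝ), (∀ α, 0 ≤ s α) →
        (∀ α : Finset A × ℕ, a ∈ α.1 → s α < 1 / (α.2 + 1)) → Tendsto s atTop (𝓝 0) := by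
      intro a s hs h
      have ht : Tendsto (fun α : Finset A × ℕ => (1 : ℝ) / (α.2 + 1)) atTop (𝓝 0) := by
        rw [← prod_atTop_atTop_eq]
        exact tendsto_one_div_add_atTop_nhds_zero_nat.comp tendsto_snd
      refine squeeze_zero' (Eventually.of_forall hs) ?_ ht
      filter_upwards [eventually_ge_atTop (({a}, 0) : Finset A × ℕ)] with α hα
      exact (h α (hα.1 (Finset.mem_singleton_self a))).le
    refine ⟨Finset A × ℕ, inferInstance, inferInstance, inferInstance,
      fun α => LCCompletion.of _ (N α), fun _ => ⟨C, fun α => ?_⟩, fun a => ?_, fun a _ => ?_⟩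
    · rw [tensorNorm, LCCompletion.seminorm_of]
      exact hN α
    · simp only [quotLeft_diagonalOp_of]
      exact LCCompletion.tendsto_of_zero fun _ =>
        key a _ (fun _ => apply_nonneg _ _) fun α ha => (hN' α a ha).2
    · simp only [tensorLeft_sub_tensorRight_of]
      exact LCCompletion.tendsto_of_zero fun _ =>
        key a _ (fun _ => apply_nonneg _ _) fun α ha => (hN' α a ha).1

end Algebraic

/-! ### Transfer along homomorphisms with dense range. -/

section Transfer

variable {𝕜 : Type*} [RCLike 𝕜] {A : Type*} [NonUnitalRing A] [Module 𝕜 A]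
  [IsScalarTower 𝕜 A A] [SMulCommClass 𝕜 A A] {B : Type*} [NonUnitalRing B] [Module 𝕜 B]
  [IsScalarTower 𝕜 B B] [SMulCommClass 𝕜 B B] (f : A →ₙₐ[𝕜] B) {I : AlgIdeal 𝕜 A}
  {J : AlgIdeal 𝕜 B} (hIJ : ∀ a ∈ I.toSubmodule, f a ∈ J.toSubmodule)

/-- The map `A / I → B / J` induced by a homomorphism `A → B` that maps `I` into `J`. -/
def AlgIdeal.quotMap : I.Quot →ₗ[𝕜] J.Quot :=
  I.toSubmodule.mapQ J.toSubmodule (f : A →ₗ[𝕜] B) hIJ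

theorem AlgIdeal.quotMap_mkQ (a : A) :
    AlgIdeal.quotMap f hIJ (I.toSubmodule.mkQ a) = J.toSubmodule.mkQ (f a) := rfl

theorem AlgIdeal.quotMap_comp_lmulQ (a : A) :
    AlgIdeal.quotMap f hIJ ∘ₗ I.lmulQ a = J.lmulQ (f a) ∘ₗ AlgIdeal.quotMap f hIJ :=
  Submodule.linearMap_qext _ <| LinearMap.ext fun x =>
    congrArg J.toSubmodule.mkQ (map_mul f a x)

theorem AlgIdeal.quotMap_comp_rmulQ (a : A) :
    AlgIdeal.quotMap f hIJ ∘ₗ I.rmulQ a = J.rmulQ (f a) ∘ₗ AlgIdeal.quotMap f hIJ :=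
  Submodule.linearMap_qext _ <| LinearMap.ext fun x =>
    congrArg J.toSubmodule.mkQ (map_mul f x a)

/-- The map of algebraic tensor products induced by a homomorphism `A → B` that maps `I`
into `J`. -/
def AlgIdeal.tensorMap : I.Quot ⊗[𝕜] I.Quot →ₗ[𝕜] J.Quot ⊗[𝕜] J.Quot :=
  TensorProduct.map (AlgIdeal.quotMap f hIJ) (AlgIdeal.quotMap f hIJ)

theorem AlgIdeal.tensorMap_commutator (a : A) (N : I.Quot ⊗[𝕜] I.Quot) :
    AlgIdeal.tensorMap f hIJ (I.tensorCommutator a N) =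
      J.tensorCommutator (f a) (AlgIdeal.tensorMap f hIJ N) := by
  have : AlgIdeal.tensorMap f hIJ ∘ₗ I.tensorCommutator a =
      J.tensorCommutator (f a) ∘ₗ AlgIdeal.tensorMap f hIJ := TensorProduct.ext' fun x y => by
    have hl := LinearMap.congr_fun (AlgIdeal.quotMap_comp_lmulQ f hIJ a) x
    have hr := LinearMap.congr_fun (AlgIdeal.quotMap_comp_rmulQ f hIJ a) y
    simp only [LinearMap.comp_apply] at hl hr
    simp [AlgIdeal.tensorCommutator, AlgIdeal.tensorMap, hl, hr]
  exact LinearMap.congr_fun this N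

theorem AlgIdeal.quotMap_lift_mulQ (N : I.Quot ⊗[𝕜] I.Quot) :
    AlgIdeal.quotMap f hIJ (TensorProduct.lift I.mulQ N) =
      TensorProduct.lift J.mulQ (AlgIdeal.tensorMap f hIJ N) := by
  have : AlgIdeal.quotMap f hIJ ∘ₗ TensorProduct.lift I.mulQ =
      TensorProduct.lift J.mulQ ∘ₗ AlgIdeal.tensorMap f hIJ := TensorProduct.ext' fun x y => by
    obtain ⟨a, rfl⟩ := I.toSubmodule.mkQ_surjective x
    obtain ⟨b, rfl⟩ := I.toSubmodule.mkQ_surjective y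
    exact congrArg J.toSubmodule.mkQ (map_mul f a b)
  exact LinearMap.congr_fun this N

theorem AlgIdeal.quotMap_unitDefect (a : A) (N : I.Quot ⊗[𝕜] I.Quot) :
    AlgIdeal.quotMap f hIJ (I.unitDefect a N) =
      J.unitDefect (f a) (AlgIdeal.tensorMap f hIJ N) := by
  have hl := LinearMap.congr_fun (AlgIdeal.quotMap_comp_lmulQ f hIJ a)
    (TensorProduct.lift I.mulQ N)
  simp only [LinearMap.comp_apply] at hl
  rw [AlgIdeal.unitDefect, AlgIdeal.unitDefect, map_sub, hl, AlgIdeal.quotMap_lift_mulQ,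
    AlgIdeal.quotMap_mkQ]

variable {ι κ : Type*} (p : ι → AlgSeminorm 𝕜 A) (q : κ → AlgSeminorm 𝕜 B) {i : ι} {j : κ} {K : ℝ}

theorem quotFamily_quotMap_le (hK : 0 ≤ K)
    (h : ∀ a, (q j).toSeminorm (f a) ≤ K * (p i).toSeminorm a) (x : I.Quot) :
    quotFamily q J j (AlgIdeal.quotMap f hIJ x) ≤ K * quotFamily p I i x := by
  rw [quotFamily, quotFamily, quotientSeminorm_apply _ _ x, Real.mul_iInf_of_nonneg hK]
  refine le_ciInf fun a => ?_
  obtain ⟨a, rfl⟩ := a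
  exact (quotientSeminorm_mkQ_le _ _ (f a)).trans (h a)

theorem tensorFamily_tensorMap_le (hK : 0 ≤ K)
    (h : ∀ a, (q j).toSeminorm (f a) ≤ K * (p i).toSeminorm a) (N : I.Quot ⊗[𝕜] I.Quot) :
    tensorFamily q J j (AlgIdeal.tensorMap f hIJ N) ≤ K ^ 2 * tensorFamily p I i N := by
  refine le_projectiveTensorSeminorm _ _ _ _ _ (by positivity) (fun x y => ?_) N
  refine (projectiveTensorSeminorm_tmul_le (quotFamily q J j) (quotFamily q J j) _ _).trans ?_
  refine (mul_le_mul (quotFamily_quotMap_le f hIJ p q hK h x)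
    (quotFamily_quotMap_le f hIJ p q hK h y) (apply_nonneg _ _)
    (mul_nonneg hK (apply_nonneg _ _))).trans_eq ?_
  ring

/-- A representative `b` of the image class differs from `f a` by an element of `J`, which is nearly
`f c` with `c ∈ I`. Then `a + c` represents the original class and `f (a + c)` is close to `b`. -/
theorem quotFamily_le_quotMap
    (hJ : ∀ b ∈ J.toSubmodule, ∀ ε > 0, ∃ a ∈ I.toSubmodule, (q j).toSeminorm (b - f a) < ε)
    (hK : 0 ≤ K) (h : ∀ a, (p i).toSeminorm a ≤ K * (q j).toSeminorm (f a)) (x : I.Quot) :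
    quotFamily p I i x ≤ K * quotFamily q J j (AlgIdeal.quotMap f hIJ x) := by
  obtain ⟨a, rfl⟩ := I.toSubmodule.mkQ_surjective x
  rw [quotFamily, quotFamily, quotientSeminorm_apply (q j).toSeminorm, Real.mul_iInf_of_nonneg hK]
  refine le_ciInf fun b => ?_
  obtain ⟨b, hb⟩ := b
  refine le_of_forall_pos_le_add fun ε hε => ?_
  rw [AlgIdeal.quotMap_mkQ] at hb
  have hbJ : b - f a ∈ J.toSubmodule := (Submodule.Quotient.eq _).1 hb
  obtain ⟨c, hc, hbc⟩ := hJ _ hbJ (ε / (K + 1)) (by positivity)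
  have hac : I.toSubmodule.mkQ a = I.toSubmodule.mkQ (a + c) :=
    (Submodule.Quotient.eq _).2 (by simpa using hc)
  refine ((congrArg _ hac).trans_le (quotientSeminorm_mkQ_le _ _ _)).trans ((h _).trans ?_)
  have h1 : (q j).toSeminorm (f (a + c)) ≤
      (q j).toSeminorm b + (q j).toSeminorm (b - f a - f c) := by
    have : f (a + c) = b - (b - f a - f c) := by rw [map_add]; abel
    rw [this]
    exact map_sub_le_add (q j).toSeminorm _ _
  have h2 : K * (ε / (K + 1)) ≤ ε := by
    rw [mul_div_assoc', div_le_iff₀ (by positivity)]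
    nlinarith
  have h3 := mul_le_mul_of_nonneg_left (h1.trans (add_le_add_right hbc.le _)) hK
  refine h3.trans ?_
  rw [mul_add]
  exact add_le_add_right h2 _

variable {p q}

theorem AlgIdeal.exists_quotMap_sub_lt
    (hd : ∀ b, ∀ ε > 0, ∃ a, (q j).toSeminorm (b - f a) < ε) (y : J.Quot) {ε : ℝ} (hε : 0 < ε) :
    ∃ x, quotFamily q J j (y - AlgIdeal.quotMap f hIJ x) < ε := by
  obtain ⟨b, rfl⟩ := J.toSubmodule.mkQ_surjective y
  obtain ⟨a, ha⟩ := hd b ε hε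
  refine ⟨I.toSubmodule.mkQ a, ?_⟩
  rw [AlgIdeal.quotMap_mkQ, ← map_sub]
  exact (quotientSeminorm_mkQ_le _ _ _).trans_lt ha

theorem AlgIdeal.exists_tensorMap_sub_lt
    (hd : ∀ b, ∀ ε > 0, ∃ a, (q j).toSeminorm (b - f a) < ε) (v : J.Quot ⊗[𝕜] J.Quot) {ε : ℝ}
    (hε : 0 < ε) : ∃ u, tensorFamily q J j (v - AlgIdeal.tensorMap f hIJ u) < ε := by
  induction v generalizing ε with
  | zero => exact ⟨0, by simpa using hε⟩
  | tmul x y =>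
    -- Each factor contributes `ε / 2`; the second tolerance depends on the approximant `e` already
    -- chosen for the first.
    obtain ⟨e, he⟩ := AlgIdeal.exists_quotMap_sub_lt f hIJ hd x
      (ε := ε / 2 / (quotFamily q J j y + 1)) (by positivity)
    obtain ⟨g, hg⟩ := AlgIdeal.exists_quotMap_sub_lt f hIJ hd y
      (ε := ε / 2 / (quotFamily q J j (AlgIdeal.quotMap f hIJ e) + 1)) (by positivity)
    refine ⟨e ⊗ₜ g, ?_⟩
    have hsplit : x ⊗ₜ[𝕜] y - AlgIdeal.tensorMap f hIJ (e ⊗ₜ g) =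
        (x - AlgIdeal.quotMap f hIJ e) ⊗ₜ y +
          AlgIdeal.quotMap f hIJ e ⊗ₜ (y - AlgIdeal.quotMap f hIJ g) := by
      rw [AlgIdeal.tensorMap, TensorProduct.map_tmul, TensorProduct.sub_tmul,
        TensorProduct.tmul_sub]
      abel
    rw [hsplit]
    refine (map_add_le_add (tensorFamily q J j) _ _).trans_lt ?_
    have h1 := projectiveTensorSeminorm_tmul_le (quotFamily q J j) (quotFamily q J j)
      (x - AlgIdeal.quotMap f hIJ e) y
    have h2 := projectiveTensorSeminorm_tmul_le (quotFamily q J j) (quotFamily q J j)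
      (AlgIdeal.quotMap f hIJ e) (y - AlgIdeal.quotMap f hIJ g)
    rw [lt_div_iff₀ (by positivity)] at he hg
    have h3 := apply_nonneg (quotFamily q J j) (x - AlgIdeal.quotMap f hIJ e)
    have h4 := apply_nonneg (quotFamily q J j) (y - AlgIdeal.quotMap f hIJ g)
    simp only [tensorFamily]
    linarith
  | add v w hv hw =>
    obtain ⟨a, ha⟩ := hv (half_pos hε)
    obtain ⟨b, hb⟩ := hw (half_pos hε)
    refine ⟨a + b, ?_⟩
    rw [map_add, add_sub_add_comm]
    refine (map_add_le_add (tensorFamily q J j) _ _).trans_lt ?_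
    linarith

include hIJ

/-- Approximate diagonals are pushed forward by bounded homomorphisms with dense range. -/
theorem HasAlgebraicApproxDiagonal.push (hK : 0 ≤ K)
    (h : ∀ a, (q j).toSeminorm (f a) ≤ K * (p i).toSeminorm a)
    (hd : ∀ b, ∀ ε > 0, ∃ a, (q j).toSeminorm (b - f a) < ε)
    (H : HasAlgebraicApproxDiagonal p I i) : HasAlgebraicApproxDiagonal q J j := by
  classical
  obtain ⟨C, hC, H⟩ := H
  set D := K ^ 2 * C + 1 with hD
  have hDpos : 0 < D := by positivity
  refine ⟨D, hDpos, fun F ε hε => ?_⟩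
  -- The factor `4 * (D + 1)` keeps both the commutator error `2 * D` and the defect error `D + 1`,
  -- times the distance, within `ε / 2`.
  choose g hg using fun b => hd b (ε / (4 * (D + 1))) (by positivity)
  -- Tensor estimates cost `K ^ 2` and quotient estimates cost `K`; this `η` absorbs either.
  set η := ε / (2 * (K ^ 2 + K + 1)) with hη
  have hηpos : 0 < η := by positivity
  have hη₁ : K ^ 2 * η + K * η < ε / 2 := by
    have : η * (2 * (K ^ 2 + K + 1)) = ε := div_mul_cancel₀ _ (by positivity)
    nlinarith
  have hη₂ : 0 ≤ K * η := by positivity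
  have hη₃ : 0 ≤ K ^ 2 * η := by positivity
  obtain ⟨N, hN, hN'⟩ := H (F.image g) η hηpos
  have hr : tensorFamily q J j (AlgIdeal.tensorMap f hIJ N) ≤ D :=
    (tensorFamily_tensorMap_le f hIJ p q hK h N).trans
      ((mul_le_mul_of_nonneg_left hN (by positivity)).trans (by linarith))
  refine ⟨AlgIdeal.tensorMap f hIJ N, hr, fun b hb => ?_⟩
  obtain ⟨h1, h2⟩ := hN' (g b) (Finset.mem_image_of_mem _ hb)
  have hb' : b = f (g b) + (b - f (g b)) := by abel
  have hgb := hg b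
  rw [lt_div_iff₀ (by positivity)] at hgb
  have hgb₀ := apply_nonneg (q j).toSeminorm (b - f (g b))
  have hmul := mul_le_mul_of_nonneg_left hr hgb₀
  constructor
  · rw [hb', J.tensorCommutator_add, ← AlgIdeal.tensorMap_commutator]
    refine (map_add_le_add (tensorFamily q J j) _ _).trans_lt ?_
    have h3 := tensorFamily_tensorMap_le f hIJ p q hK h (I.tensorCommutator (g b) N)
    have h4 := tensorFamily_commutator_le q J j (b - f (g b)) (AlgIdeal.tensorMap f hIJ N)
    have h5 := mul_le_mul_of_nonneg_left h1.le (sq_nonneg K)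
    linarith
  · rw [hb', J.unitDefect_add, ← AlgIdeal.quotMap_unitDefect]
    refine (map_add_le_add (quotFamily q J j) _ _).trans_lt ?_
    have h3 := quotFamily_quotMap_le f hIJ p q hK h (I.unitDefect (g b) N)
    have h4 := quotFamily_unitDefect_le q J j (b - f (g b)) (AlgIdeal.tensorMap f hIJ N)
    have h5 := mul_le_mul_of_nonneg_left h2.le hK
    linarith

/-- Approximate diagonals are pulled back along homomorphisms with dense range that are bounded
below, when the ideal upstairs has dense image in the ideal downstairs. -/
theorem HasAlgebraicApproxDiagonal.pull (hK : 1 ≤ K)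
    (h : ∀ a, (p i).toSeminorm a ≤ K * (q j).toSeminorm (f a))
    (hd : ∀ b, ∀ ε > 0, ∃ a, (q j).toSeminorm (b - f a) < ε)
    (hJ : ∀ b ∈ J.toSubmodule, ∀ ε > 0, ∃ a ∈ I.toSubmodule, (q j).toSeminorm (b - f a) < ε)
    (H : HasAlgebraicApproxDiagonal q J j) : HasAlgebraicApproxDiagonal p I i := by
  classical
  obtain ⟨C, hC, H⟩ := H
  have hK₀ : 0 ≤ K := zero_le_one.trans hK
  have hq := quotFamily_le_quotMap f hIJ p q hJ hK₀ h
  have hr : ∀ u, tensorFamily p I i u ≤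
      K ^ 2 * tensorFamily q J j (AlgIdeal.tensorMap f hIJ u) :=
    projectiveTensorSeminorm_le_map (quotFamily p I i) (quotFamily q J j)
      (AlgIdeal.quotMap f hIJ) (fun y ε hε => AlgIdeal.exists_quotMap_sub_lt f hIJ hd y hε) hK₀ hq
  refine ⟨K ^ 2 * (C + 1), by positivity, fun F ε hε => ?_⟩
  set η := ε / (2 * K ^ 2) with hη
  have hηpos : 0 < η := by positivity
  have hKη : K ^ 2 * (2 * η) = ε := by rw [hη]; field_simp
  obtain ⟨M, hM, hM'⟩ := H (F.image f) η hηpos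
  obtain ⟨R, hR⟩ := (F.image fun a => (q j).toSeminorm (f a)).bddAbove
  -- `M` need not come from `A / I`, so it is approximated by an image; the error `d` costs at most
  -- `η`, whence the bound `2 * η` below.
  obtain ⟨N, hN⟩ := AlgIdeal.exists_tensorMap_sub_lt f hIJ hd M
    (ε := min 1 (η / (2 * (|R| + 1)))) (by positivity)
  set d := M - AlgIdeal.tensorMap f hIJ N with hd'
  have hN₁ := hN.trans_le (min_le_left _ _)
  have hN₂ := (lt_div_iff₀ (by positivity)).1 (hN.trans_le (min_le_right _ _))
  have hNM : AlgIdeal.tensorMap f hIJ N = M - d := by rw [hd']; abel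
  have hd₀ := apply_nonneg (tensorFamily q J j) d
  refine ⟨N, (hr N).trans ?_, fun a ha => ?_⟩
  · refine mul_le_mul_of_nonneg_left ?_ (by positivity)
    rw [hNM]
    exact (map_sub_le_add (tensorFamily q J j) _ _).trans (add_le_add hM hN₁.le)
  obtain ⟨h1, h2⟩ := hM' (f a) (Finset.mem_image_of_mem _ ha)
  have hRa : (q j).toSeminorm (f a) ≤ |R| :=
    (hR (Finset.mem_coe.2 (Finset.mem_image_of_mem _ ha))).trans (le_abs_self R)
  have hmul := mul_le_mul_of_nonneg_right hRa hd₀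
  constructor
  · refine (hr _).trans_lt ?_
    rw [AlgIdeal.tensorMap_commutator, hNM, map_sub, ← hKη]
    refine mul_lt_mul_of_pos_left ?_ (by positivity)
    refine (map_sub_le_add (tensorFamily q J j) _ _).trans_lt ?_
    have h4 := tensorFamily_commutator_le q J j (f a) d
    linarith
  · refine (hq _).trans_lt ?_
    have hsplit : J.unitDefect (f a) (M - d) =
        J.unitDefect (f a) M - J.lmulQ (f a) (TensorProduct.lift J.mulQ d) := by
      simp only [AlgIdeal.unitDefect, map_sub]
      abel
    rw [AlgIdeal.quotMap_unitDefect, hNM, hsplit, ← hKη]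
    have h4 := quotFamily_lmulQ_lift_mulQ_le q J j (f a) d
    have h5 : quotFamily q J j (J.unitDefect (f a) M -
        J.lmulQ (f a) (TensorProduct.lift J.mulQ d)) < 2 * η :=
      (map_sub_le_add (quotFamily q J j) _ _).trans_lt (by linarith)
    -- Since `1 ≤ K`, the factor `K` is at most `K ^ 2`, and the choice of `η` made for tensors also
    -- serves the quotient.
    refine (mul_le_mul_of_nonneg_right (le_self_pow₀ hK two_ne_zero) (apply_nonneg _ _)).trans_lt ?_
    exact mul_lt_mul_of_pos_left h5 (by positivity)

end Transfer

/-! ### Comparing the two defining systems of seminorms. -/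

section ArensMichael

variable {𝕜 : Type*} [RCLike 𝕜] {A : Type*} [NonUnitalRing A] [Module 𝕜 A]
  [UniformSpace A] [IsUniformAddGroup A] {B : ℕ → Type*} [∀ n, NonUnitalNormedRing (B n)]
  [∀ n, NormedSpace 𝕜 (B n)] (D : ArensMichaelDecomposition 𝕜 A B)

theorem ArensMichaelDecomposition.continuous_proj (n : ℕ) : Continuous (D.proj n) :=
  (continuous_apply n).comp D.isEmbedding_proj.continuous

theorem ArensMichaelDecomposition.link_proj (n : ℕ) (a : A) :
    D.link n (D.proj (n + 1) a) = D.proj n a := by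
  have : (fun n => D.proj n a) ∈ {x : ∀ n, B n | ∀ n, D.link n (x (n + 1)) = x n} :=
    D.range_proj ▸ Set.mem_range_self a
  exact this n

theorem ArensMichaelDecomposition.exists_norm_proj_le_of_le {m n : ℕ} (hmn : m ≤ n) :
    ∃ C : ℝ, 0 ≤ C ∧ ∀ a, ‖D.proj m a‖ ≤ C * ‖D.proj n a‖ := by
  induction n, hmn using Nat.le_induction with
  | base => exact ⟨1, zero_le_one, fun a => (one_mul _).ge⟩
  | succ n _ ih =>
    obtain ⟨C, hC, h⟩ := ih
    let T : B (n + 1) →L[𝕜] B n := ⟨(D.link n : B (n + 1) →ₗ[𝕜] B n), D.continuous_link n⟩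
    refine ⟨C * ‖T‖, by positivity, fun a => (h a).trans ?_⟩
    rw [mul_assoc, ← D.link_proj]
    exact mul_le_mul_of_nonneg_left (T.le_opNorm _) hC

/-- The topology is induced from the product of the `B n`; `Fin 1` indexes the norm of each factor
as a one-element family. -/
theorem ArensMichaelDecomposition.withSeminorms :
    WithSeminorms fun k : Σ _ : ℕ, Fin 1 =>
      (normSeminorm 𝕜 (B k.1)).comp (D.proj k.1 : A →ₗ[𝕜] B k.1) :=
  IsInducing.withSeminorms (withSeminorms_pi fun n => norm_withSeminorms 𝕜 (B n))
    (f := LinearMap.pi fun n => (D.proj n : A →ₗ[𝕜] B n)) D.isEmbedding_proj.isInducing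

/-- Continuity bounds `p` by finitely many norms, and the linking maps dominate these by a single
norm at a later level. -/
theorem ArensMichaelDecomposition.exists_seminorm_le (p : Seminorm 𝕜 A) (hp : Continuous p) :
    ∃ m, ∃ K : ℝ, 1 ≤ K ∧ ∀ a, p a ≤ K * ‖D.proj m a‖ := by
  classical
  obtain ⟨s, C, -, h⟩ := Seminorm.bound_of_continuous D.withSeminorms p hp
  obtain ⟨m, hm⟩ := (s.image Sigma.fst).bddAbove
  replace hm : ∀ k ∈ s, k.1 ≤ m := fun k hk =>
    hm (Finset.mem_coe.2 (Finset.mem_image_of_mem Sigma.fst hk))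
  choose! c hc₀ hc using fun k (hk : k ≤ m) => D.exists_norm_proj_le_of_le hk
  have hsum : 0 ≤ ∑ k ∈ s, c k.1 := Finset.sum_nonneg fun k hk => hc₀ k.1 (hm k hk)
  -- The added `1` secures `1 ≤ K`, as the pullback requires.
  refine ⟨m, C * ∑ k ∈ s, c k.1 + 1, ?_, fun a => (h a).trans ?_⟩
  · simpa using mul_nonneg C.2 hsum
  · have h1 := Seminorm.finset_sup_apply_le (x := a)
      (p := fun k : Σ _ : ℕ, Fin 1 => (normSeminorm 𝕜 (B k.1)).comp (D.proj k.1 : A →ₗ[𝕜] B k.1))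
      (s := s) (mul_nonneg hsum (norm_nonneg (D.proj m a))) fun k hk =>
        (hc k.1 (hm k hk) a).trans (mul_le_mul_of_nonneg_right
          (Finset.single_le_sum (f := fun k => c k.1) (fun l hl => hc₀ l.1 (hm l hl)) hk)
          (norm_nonneg _))
    refine (mul_le_mul_of_nonneg_left h1 C.2).trans ?_
    have h4 := norm_nonneg (D.proj m a)
    change (C : ℝ) * _ ≤ _
    linarith

theorem ArensMichaelDecomposition.exists_norm_proj_le {p : ℕ → AlgSeminorm 𝕜 A}
    (hp : WithSeminorms fun n => (p n).toSeminorm) (hmono : Monotone fun n => (p n).toSeminorm)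
    (n : ℕ) : ∃ m, ∃ K : ℝ, 0 ≤ K ∧ ∀ a, ‖D.proj n a‖ ≤ K * (p m).toSeminorm a := by
  obtain ⟨s, C, -, h⟩ := Seminorm.bound_of_continuous hp
    ((normSeminorm 𝕜 (B n)).comp (D.proj n : A →ₗ[𝕜] B n)) (D.continuous_proj n).norm
  obtain ⟨m, hm⟩ := s.bddAbove
  have hle : s.sup (fun n => (p n).toSeminorm) ≤ (p m).toSeminorm :=
    Finset.sup_le fun k hk => hmono (hm hk)
  exact ⟨m, C, C.2, fun a => (h a).trans (mul_le_mul_of_nonneg_left (hle a) C.2)⟩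

theorem AlgIdeal.map_mem_mapClosure {C : Type*} [NonUnitalNormedRing C] [NormedSpace 𝕜 C]
    (I : AlgIdeal 𝕜 A) (f : A →ₙₐ[𝕜] C) (hf : DenseRange f) {a : A} (ha : a ∈ I.toSubmodule) :
    f a ∈ (I.mapClosure f hf).toSubmodule :=
  subset_closure ⟨a, ha, rfl⟩

theorem AlgIdeal.exists_norm_sub_lt_of_mem_mapClosure {C : Type*} [NonUnitalNormedRing C]
    [NormedSpace 𝕜 C] (I : AlgIdeal 𝕜 A) (f : A →ₙₐ[𝕜] C) (hf : DenseRange f) {b : C}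
    (hb : b ∈ (I.mapClosure f hf).toSubmodule) {ε : ℝ} (hε : 0 < ε) :
    ∃ a ∈ I.toSubmodule, ‖b - f a‖ < ε := by
  obtain ⟨_, ⟨a, ha, rfl⟩, h⟩ := Metric.mem_closure_iff.1 hb ε hε
  exact ⟨a, ha, by rwa [dist_eq_norm] at h⟩

theorem DenseRange.exists_norm_sub_lt {α C : Type*} [SeminormedAddCommGroup C] {f : α → C}
    (hf : DenseRange f) (b : C) {ε : ℝ} (hε : 0 < ε) : ∃ a, ‖b - f a‖ < ε := by
  simpa only [dist_eq_norm] using hf.exists_dist_lt b hε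

end ArensMichael

end

/-! ### The equivalence. -/

theorem mainTheorem4 {𝕜 : Type*} [RCLike 𝕜]
    {A : Type u} [NonUnitalRing A] [Module 𝕜 A] [IsScalarTower 𝕜 A A] [SMulCommClass 𝕜 A A]
    [UniformSpace A] [IsUniformAddGroup A]
    (p : ℕ → AlgSeminorm 𝕜 A) (hA : IsFrechetAlgebra p)
    (I : AlgIdeal 𝕜 A) (hI : IsClosed (I.toSubmodule : Set A))
    (B : ℕ → Type v) [∀ n, NonUnitalNormedRing (B n)] [∀ n, NormedSpace 𝕜 (B n)]
    [∀ n, IsScalarTower 𝕜 (B n) (B n)] [∀ n, SMulCommClass 𝕜 (B n) (B n)]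
    (D : ArensMichaelDecomposition 𝕜 A B) :
    HasLocallyBoundedApproxDiagonal p I ↔
      ∀ n, BanachHasBoundedApproxDiagonal (D.idealClosure I n) := by
  simp only [hasLocallyBoundedApproxDiagonal_iff, BanachHasBoundedApproxDiagonal,
    hasBoundedApproxDiagonal_iff]
  have hmem : ∀ n, ∀ a ∈ I.toSubmodule, D.proj n a ∈ (D.idealClosure I n).toSubmodule :=
    fun n a ha => I.map_mem_mapClosure _ (D.denseRange_proj n) ha
  constructor
  · intro H n
    obtain ⟨m, K, hK, h⟩ := D.exists_norm_proj_le hA.withSeminorms hA.monotone n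
    exact (H m).push (D.proj n) (hmem n) hK h
      fun b ε hε => (D.denseRange_proj n).exists_norm_sub_lt b hε
  · intro H n
    obtain ⟨m, K, hK, h⟩ := D.exists_seminorm_le (p n).toSeminorm
      (hA.withSeminorms.continuous_seminorm n)
    exact (H m).pull (D.proj m) (hmem m) hK h
      (fun b ε hε => (D.denseRange_proj m).exists_norm_sub_lt b hε)
      fun b hb ε hε => I.exists_norm_sub_lt_of_mem_mapClosure _ (D.denseRange_proj m) hb hε
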